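/- Let $A,B$ be positive semidefinite complex $n\times n$ matrices and let $q\ge 0$. Write $\|A\|$ for the operator norm, and for a positive semidefinite $X$ and $p\ge 0$ write $\operatorname{Tr}[X]^{p}$ for the trace of the matrix power $X^{p}$ (functional calculus, with $X^0=I$). Then for $0\le r\le 1$ $$\operatorname{Tr}[ABA]^{rq}\;\le\;\left(\|A\|^{2rq}\,\operatorname{Tr}B^{rq}\right)^{1-r}\left(\operatorname{Tr}[A^rB^rA^r]^{q}\right)^{r},$$ and for $r\ge 1$ the inequality is reversed: $$\operatorname{Tr}[ABA]^{rq}\;\ge\;\left(\|A\|^{2rq}\,\operatorname{Tr}B^{rq}\right)^{1-r}\left(\operatorname{Tr}[A^rB^rA^r]^{q}\right)^{r}.$$ Here $0^0=1$, and in the degenerate case $r>1$, $\|A\|^{2rq}\operatorname{Tr}B^{rq}=0$ the right-hand side is read as $0$. -/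

import Mathlib

/- `Matrix.Norms.L2Operator`: the norm of a matrix is its operator norm for the Euclidean norm.
`ComplexOrder`, `MatrixOrder`: the order on `ℂ` and the Loewner order, which makes the real powers `X ^ (p : ℝ)` of positive
semidefinite matrices (functional calculus, with `X ^ (0 : ℝ) = 1`) available. -/
open scoped ComplexOrder MatrixOrder Matrix.Norms.L2Operator

/-!
For `0 < r < 1` the inequality is Hölder's inequality for Schatten quasi-norms, with exponents
`2rq / (1-r)`, `2q` and `∞`, applied to
`B ^ (1/2) * A = B ^ ((1-r)/2) * (B ^ (r/2) * A ^ r) * A ^ (1-r)`.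
The exponents `2rq / (1-r)` and `2q` may lie below `1`, so duality of norms is not available, and
Hölder's inequality is obtained from a logarithmic weak majorization of eigenvalues instead:

* `Matrix.PosSemidef.det_compression_le` bounds `det (Qᴴ * C * Q)` by
  `det (Qᴴ * Q) * c ^ k * ∏ max 1 (γᵢ / c)`, where `Q` has `k` columns, the `γᵢ` are the eigenvalues
  of `C ≥ 0`, and `c > 0` is arbitrary. It rests on the monotonicity of the determinant and the
  Weinstein–Aronszajn identity.
* Taking for the columns of `Q` the vectors `Y v`, with `v` running through the eigenvectors of
  `Yᴴ * C * Y` above the cut-off, gives `Matrix.PosSemidef.sum_posLog_eigenvalues_le`: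
  `∑ log⁺ (τᵢ / (a * b)) ≤ ∑ log⁺ (γᵢ / a) + ∑ log⁺ (μᵢ / b)` for the eigenvalues `τ`, `γ`, `μ` of
  `Yᴴ * C * Y`, `C`, `Yᴴ * Y`. With two independent cut-offs the eigenvalues need not be sorted.
* A power `x ^ (s / w)` is a positive multiple of `∫ exp (s * u) * log⁺ (x / exp (w * u)) du`.
  Integrating the previous inequality along `a = exp ((1-r) * u)`, `b = exp (r * u)` therefore
  yields a Young inequality between sums of powers, and its scaling invariance turns it into
  Hölder's (`sum_rpow_le_mul_of_sum_posLog_le`).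

For `r > 1` the reversed inequality is the first one for `A ^ r`, `B ^ r` and the exponents
`r * q`, `r⁻¹`.
-/

/-! ### Determinants of compressions and logarithmic majorization of eigenvalues -/

namespace Matrix

section Determinants

variable {m n : Type*} [Fintype m] [DecidableEq m] [Fintype n] [DecidableEq n]

lemma det_conjStarAlgAut (U : unitary (Matrix n n ℂ)) (M : Matrix n n ℂ) :
    (Unitary.conjStarAlgAut ℂ _ U M).det = M.det := by
  rw [Unitary.conjStarAlgAut_apply, det_mul_comm, ← mul_assoc]
  simp

lemma posSemidef_conjStarAlgAut_diagonal (U : unitary (Matrix n n ℂ)) {d : n → ℝ}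
    (hd : ∀ i, 0 ≤ d i) :
    (Unitary.conjStarAlgAut ℂ _ U (diagonal fun i ↦ (d i : ℂ))).PosSemidef := by
  rw [Unitary.conjStarAlgAut_apply, star_eq_conjTranspose]
  exact (PosSemidef.diagonal fun i ↦ by simpa using hd i).mul_mul_conjTranspose_same _

lemma PosSemidef.one_le_det_one_add {X : Matrix n n ℂ} (hX : X.PosSemidef) :
    1 ≤ (1 + X).det := by
  have h : (1 + X) = Unitary.conjStarAlgAut ℂ _ hX.1.eigenvectorUnitary
      (1 + diagonal (RCLike.ofReal ∘ hX.1.eigenvalues)) := by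
    rw [map_add, map_one, ← hX.1.spectral_theorem]
  have hprod : 1 ≤ ∏ i, (1 + hX.1.eigenvalues i) :=
    Finset.one_le_prod fun i _ ↦ le_add_of_nonneg_right (hX.eigenvalues_nonneg i)
  rw [h, det_conjStarAlgAut, ← diagonal_one, diagonal_add, det_diagonal]
  have hprod' : (1 : ℂ) ≤ ((∏ i, (1 + hX.1.eigenvalues i) : ℝ) : ℂ) := by exact_mod_cast hprod
  push_cast at hprod'
  exact hprod'

lemma PosSemidef.exists_eq_conjTranspose_mul_self {X : Matrix n n ℂ} (hX : X.PosSemidef) :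
    ∃ R : Matrix n n ℂ, X = Rᴴ * R :=
  CStarAlgebra.nonneg_iff_eq_star_mul_self.mp hX.nonneg

/-- The determinant is monotone on positive semidefinite matrices. -/
lemma PosSemidef.det_le_det_add {X H : Matrix n n ℂ} (hX : X.PosSemidef) (hH : H.PosSemidef) :
    X.det ≤ (X + H).det := by
  by_cases h0 : X.det = 0
  · rw [h0]
    exact (hX.add hH).det_nonneg
  have hu : IsUnit X.det := isUnit_iff_ne_zero.mpr h0
  obtain ⟨R, rfl⟩ := hH.exists_eq_conjTranspose_mul_self
  have h1 : X + Rᴴ * R = X * (1 + (X⁻¹ * Rᴴ) * R) := by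
    rw [mul_add, mul_one, mul_assoc, mul_nonsing_inv_cancel_left _ _ hu]
  rw [h1, det_mul, det_one_add_mul_comm]
  refine le_mul_of_one_le_right hX.det_nonneg ?_
  rw [← mul_assoc]
  exact (hX.inv.mul_mul_conjTranspose_same R).one_le_det_one_add

/-- Compressing `1 + Rᴴ * R` by `Q` multiplies the determinant of `Qᴴ * Q` by at most
`det (1 + Rᴴ * R)`: by the Weinstein–Aronszajn identity the quotient of the two is
`det (1 + R * P * Rᴴ)`, with `P` the orthogonal projection onto the range of `Q`. -/
lemma det_compression_one_add_le (Q : Matrix n m ℂ) (R : Matrix n n ℂ) :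
    (Qᴴ * (1 + Rᴴ * R) * Q).det ≤ (Qᴴ * Q).det * (1 + Rᴴ * R).det := by
  have hD := posSemidef_conjTranspose_mul_self R
  by_cases h0 : (Qᴴ * Q).det = 0
  · obtain ⟨v, hv, hv0⟩ := exists_mulVec_eq_zero_iff.mpr h0
    have hQv : Q *ᵥ v = 0 := by
      exact (conjTranspose_mul_self_mulVec_eq_zero Q v).mp hv0
    have : (Qᴴ * (1 + Rᴴ * R) * Q).det = 0 :=
      exists_mulVec_eq_zero_iff.mp ⟨v, hv, by rw [← mulVec_mulVec, hQv, mulVec_zero]⟩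
    rw [this, h0, zero_mul]
  have hu : IsUnit (Qᴴ * Q).det := isUnit_iff_ne_zero.mpr h0
  set G := Qᴴ * Q with hG
  have hGh : G⁻¹ᴴ = G⁻¹ := by
    rw [conjTranspose_nonsing_inv, (isHermitian_conjTranspose_mul_self Q).eq]
  have h1 : Qᴴ * (1 + Rᴴ * R) * Q = G * (1 + (G⁻¹ * (Qᴴ * Rᴴ)) * (R * Q)) := by
    rw [Matrix.mul_add, Matrix.mul_add, Matrix.add_mul, Matrix.mul_one, Matrix.mul_one,
      Matrix.mul_assoc G⁻¹, mul_nonsing_inv_cancel_left _ _ hu, hG]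
    simp only [Matrix.mul_assoc]
  -- `S` is the complementary projection.
  let S : Matrix n n ℂ := 1 - Q * G⁻¹ * Qᴴ
  have hSS : Sᴴ * S = S := by
    have hP : (Q * G⁻¹ * Qᴴ) * (Q * G⁻¹ * Qᴴ) = Q * G⁻¹ * Qᴴ := by
      calc (Q * G⁻¹ * Qᴴ) * (Q * G⁻¹ * Qᴴ) = Q * (G⁻¹ * G) * G⁻¹ * Qᴴ := by
            simp only [hG, Matrix.mul_assoc]
        _ = _ := by rw [nonsing_inv_mul _ hu, Matrix.mul_one]
    have hSh : Sᴴ = S := by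
      simp [S, conjTranspose_sub, conjTranspose_mul, hGh, Matrix.mul_assoc]
    rw [hSh]
    simp only [S, sub_mul, mul_sub, one_mul, mul_one, hP, sub_self, sub_zero]
  have h2 : (1 + Rᴴ * R).det = (1 + R * Q * (G⁻¹ * (Qᴴ * Rᴴ)) + (S * Rᴴ)ᴴ * (S * Rᴴ)).det := by
    rw [det_one_add_mul_comm]
    congr 1
    have : (S * Rᴴ)ᴴ * (S * Rᴴ) = R * S * Rᴴ := by
      rw [conjTranspose_mul, conjTranspose_conjTranspose, ← hSS]
      simp only [Matrix.mul_assoc]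
      rw [← Matrix.mul_assoc Sᴴ S, hSS, ← Matrix.mul_assoc Sᴴ S, hSS]
    rw [this]
    simp only [S, mul_sub, sub_mul, Matrix.mul_assoc, mul_one]
    abel
  rw [h1, det_mul, det_one_add_mul_comm, h2]
  refine mul_le_mul_of_nonneg_left ?_ (posSemidef_conjTranspose_mul_self Q).det_nonneg
  refine PosSemidef.det_le_det_add (.add .one ?_) (posSemidef_conjTranspose_mul_self _)
  have := (posSemidef_conjTranspose_mul_self Q).inv.mul_mul_conjTranspose_same (R * Q)
  rwa [conjTranspose_mul, Matrix.mul_assoc (R * Q)] at this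

/-- The effect of `C` on the Gram determinant of the columns of `Q`. It is bounded by replacing
`C` with the larger matrix `c • E`, where `E ≥ 1` has the eigenvalues `max 1 (γᵢ / c)`. -/
lemma PosSemidef.det_compression_le {C : Matrix n n ℂ} (hC : C.PosSemidef) (Q : Matrix n m ℂ)
    {c : ℝ} (hc : 0 < c) :
    (Qᴴ * C * Q).det ≤ (Qᴴ * Q).det *
      ((c ^ Fintype.card m * ∏ i, max 1 (hC.1.eigenvalues i / c) : ℝ) : ℂ) := by
  set U := hC.1.eigenvectorUnitary
  set γ := hC.1.eigenvalues
  have hspec : C = Unitary.conjStarAlgAut ℂ _ U (diagonal fun i ↦ (γ i : ℂ)) :=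
    hC.1.spectral_theorem
  set E := Unitary.conjStarAlgAut ℂ _ U (diagonal fun i ↦ ((max 1 (γ i / c) : ℝ) : ℂ)) with hE
  have hE1 : (E - 1).PosSemidef := by
    have h := posSemidef_conjStarAlgAut_diagonal U (d := fun i ↦ max 1 (γ i / c) - 1)
      fun i ↦ sub_nonneg.mpr (le_max_left _ _)
    convert h using 1
    rw [hE, ← map_one (Unitary.conjStarAlgAut ℂ _ U), ← map_sub, ← diagonal_one, diagonal_sub]
    simp
  have hEC : ((c : ℂ) • E - C).PosSemidef := by
    have h := posSemidef_conjStarAlgAut_diagonal U (d := fun i ↦ c * max 1 (γ i / c) - γ i)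
      fun i ↦ sub_nonneg.mpr <| by
        calc γ i = c * (γ i / c) := by field_simp
          _ ≤ _ := by gcongr; exact le_max_right _ _
    convert h using 1
    rw [hspec, hE, ← map_smul, ← map_sub, ← diagonal_smul, diagonal_sub]
    simp
  obtain ⟨R, hR⟩ := hE1.exists_eq_conjTranspose_mul_self
  have hER : E = 1 + Rᴴ * R := by rw [← hR]; abel
  have hdetE : E.det = ((∏ i, max 1 (γ i / c) : ℝ) : ℂ) := by
    rw [hE, det_conjStarAlgAut, det_diagonal]; push_cast; rfl
  calc (Qᴴ * C * Q).det ≤ (Qᴴ * C * Q + Qᴴ * ((c : ℂ) • E - C) * Q).det :=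
        (hC.conjTranspose_mul_mul_same Q).det_le_det_add (hEC.conjTranspose_mul_mul_same Q)
    _ = ((c : ℂ) • (Qᴴ * E * Q)).det := by
        congr 1
        rw [← Matrix.add_mul, ← Matrix.mul_add, add_sub_cancel, Matrix.mul_smul, Matrix.smul_mul]
    _ = (c : ℂ) ^ Fintype.card m * (Qᴴ * E * Q).det := det_smul _ _
    _ ≤ (c : ℂ) ^ Fintype.card m * ((Qᴴ * Q).det * E.det) := by
        refine mul_le_mul_of_nonneg_left ?_ (pow_nonneg (by exact_mod_cast hc.le) _)
        rw [hER]
        exact det_compression_one_add_le Q R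
    _ = _ := by rw [hdetE]; push_cast; ring

open Real in
/-- A form of Horn's inequality `∏ σᵢ(X * Y) ≤ ∏ σᵢ(X) * σᵢ(Y)` (products over the largest `k`
singular values, for every `k`) that needs no ordering of the eigenvalues: the cut-offs `a` and `b`
take the place of `k`. -/
theorem PosSemidef.sum_posLog_eigenvalues_le {C M T Y : Matrix n n ℂ} (hC : C.PosSemidef)
    (hM : M.PosSemidef) (hT : T.PosSemidef) (hMY : M = Yᴴ * Y) (hTY : T = Yᴴ * C * Y)
    {a b : ℝ} (ha : 0 < a) (hb : 0 < b) :
    ∑ i, log⁺ (hT.1.eigenvalues i / (a * b)) ≤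
      ∑ i, log⁺ (hC.1.eigenvalues i / a) + ∑ i, log⁺ (hM.1.eigenvalues i / b) := by
  set τ := hT.1.eigenvalues
  set U := hT.1.eigenvectorUnitary
  let K := {i : n // a * b < τ i}
  -- `V` has the eigenvectors of `T` with eigenvalue above the cut-off as columns.
  let V : Matrix n K ℂ := (U : Matrix n n ℂ).submatrix id Subtype.val
  have hVV : Vᴴ * V = 1 := by
    have : Vᴴ * V = ((U : Matrix n n ℂ)ᴴ * U).submatrix Subtype.val Subtype.val := rfl
    rw [this, ← star_eq_conjTranspose, Unitary.coe_star_mul_self,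
      submatrix_one _ Subtype.val_injective]
  have hVTV : Vᴴ * T * V = diagonal fun i : K ↦ (τ i : ℂ) := by
    have h1 : Vᴴ * T * V =
        ((U : Matrix n n ℂ)ᴴ * T * U).submatrix Subtype.val Subtype.val := rfl
    have h2 : (U : Matrix n n ℂ)ᴴ * T * U = diagonal fun i ↦ (τ i : ℂ) := by
      have := hT.1.conjStarAlgAut_star_eigenvectorUnitary
      rw [Unitary.conjStarAlgAut_star_apply] at this
      exact this
    rw [h1, h2, submatrix_diagonal _ _ Subtype.val_injective]
    rfl
  have hγ := hC.eigenvalues_nonneg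
  have hμ := hM.eigenvalues_nonneg
  have hdet : ∏ i : K, τ i ≤ (b ^ Fintype.card K * ∏ i, max 1 (hM.1.eigenvalues i / b)) *
      (a ^ Fintype.card K * ∏ i, max 1 (hC.1.eigenvalues i / a)) := by
    have h1 := hC.det_compression_le (Y * V) ha
    have h2 := hM.det_compression_le V hb
    have e1 : (Y * V)ᴴ * C * (Y * V) = Vᴴ * T * V := by
      simp only [hTY, conjTranspose_mul, Matrix.mul_assoc]
    have e2 : (Y * V)ᴴ * (Y * V) = Vᴴ * M * V := by
      simp only [hMY, conjTranspose_mul, Matrix.mul_assoc]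
    rw [e1, e2, hVTV, det_diagonal] at h1
    rw [hVV, det_one, one_mul] at h2
    have h3 := h1.trans (mul_le_mul_of_nonneg_right h2 (by
      rw [Complex.zero_le_real]; positivity))
    exact_mod_cast h3
  have hab : 0 < a * b := mul_pos ha hb
  have hprod : ∏ i : K, (τ i / (a * b)) ≤
      (∏ i, max 1 (hC.1.eigenvalues i / a)) * ∏ i, max 1 (hM.1.eigenvalues i / b) := by
    rw [Finset.prod_div_distrib, Finset.prod_const, Finset.card_univ, div_le_iff₀ (by positivity)]
    calc _ ≤ _ := hdet
      _ = _ := by rw [mul_pow]; ring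
  have hsum : ∑ i, log⁺ (τ i / (a * b)) = ∑ i : K, log (τ i / (a * b)) := by
    have h0 : ∑ i with a * b < τ i, log⁺ (τ i / (a * b)) = ∑ i, log⁺ (τ i / (a * b)) := by
      refine Finset.sum_filter_of_ne fun i _ hi ↦ ?_
      contrapose! hi
      rw [posLog_eq_zero_iff, abs_of_nonneg (div_nonneg (hT.eigenvalues_nonneg i) hab.le)]
      exact (div_le_one hab).mpr hi
    rw [← h0, Finset.sum_subtype (p := fun i ↦ a * b < τ i) _ (by simp)]
    refine Finset.sum_congr rfl fun i _ ↦ posLog_eq_log ?_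
    exact ((one_le_div hab).mpr i.2.le).trans (le_abs_self _)
  have hlog : ∀ (x : n → ℝ) (c : ℝ), 0 < c → (∀ i, 0 ≤ x i) →
      ∑ i, log⁺ (x i / c) = log (∏ i, max 1 (x i / c)) := by
    intro x c hc hx
    rw [log_prod fun i _ ↦ (lt_max_of_lt_left one_pos).ne']
    exact Finset.sum_congr rfl fun i _ ↦ posLog_eq_log_max_one (div_nonneg (hx i) hc.le)
  rw [hsum, hlog _ a ha hγ, hlog _ b hb hμ, ← log_prod fun i _ ↦ (div_pos (hab.trans i.2) hab).ne',
    ← log_mul (Finset.prod_pos fun i _ ↦ lt_max_of_lt_left one_pos).ne'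
      (Finset.prod_pos fun i _ ↦ lt_max_of_lt_left one_pos).ne']
  exact log_le_log (Finset.prod_pos fun i _ ↦ div_pos (hab.trans i.2) hab) hprod

end Determinants

end Matrix

/-! ### From logarithmic majorization to Hölder's inequality for sums -/

section Scalars

open Real MeasureTheory

/-- The substitution `v = L - u`, `L = log x / w`, turns the integrand `exp (s * u) * log⁺ _` into a
Gamma density. -/
lemma exp_mul_posLog_eq_indicator {x s w : ℝ} (hx : 0 < x) (hw : 0 < w) (u : ℝ) :
    exp (s * u) * log⁺ (x / exp (w * u)) = w * exp (s * (log x / w)) *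
      (Set.Ioi 0).indicator (fun v ↦ v ^ ((2 : ℝ) - 1) * exp (-(s * v))) (log x / w - u) := by
  have hlog : log (x / exp (w * u)) = w * (log x / w - u) := by
    rw [log_div hx.ne' (exp_ne_zero _), log_exp]; field_simp
  rw [posLog_apply, hlog]
  by_cases h : 0 < log x / w - u
  · rw [Set.indicator_of_mem (by exact h), max_eq_right (by positivity)]
    have : exp (s * u) = exp (s * (log x / w)) * exp (-(s * (log x / w - u))) := by
      rw [← exp_add]; ring_nf
    rw [this]
    norm_num
    ring
  · rw [Set.indicator_of_notMem (by exact h),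
      max_eq_left (mul_nonpos_of_nonneg_of_nonpos hw.le (not_lt.mp h))]
    simp

lemma integral_gamma_two_indicator {s : ℝ} (hs : 0 < s) :
    ∫ v, (Set.Ioi 0).indicator (fun v ↦ v ^ ((2 : ℝ) - 1) * exp (-(s * v))) v = 1 / s ^ 2 := by
  rw [integral_indicator measurableSet_Ioi, integral_rpow_mul_exp_neg_mul_Ioi two_pos hs,
    Gamma_two]
  norm_num

lemma integrable_exp_mul_posLog {x s w : ℝ} (hx : 0 ≤ x) (hs : 0 < s) (hw : 0 < w) :
    Integrable fun u ↦ exp (s * u) * log⁺ (x / exp (w * u)) := by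
  rcases hx.eq_or_lt with rfl | hx
  · simp
  simp_rw [exp_mul_posLog_eq_indicator hx hw]
  refine Integrable.const_mul (Integrable.comp_sub_left ?_ _) _
  refine .of_integral_ne_zero ?_
  rw [integral_gamma_two_indicator hs]
  positivity

/-- Powers are superpositions of the functions `x ↦ log⁺ (x / c)`. -/
lemma integral_exp_mul_posLog {x s w : ℝ} (hx : 0 ≤ x) (hs : 0 < s) (hw : 0 < w) :
    ∫ u, exp (s * u) * log⁺ (x / exp (w * u)) = w * x ^ (s / w) / s ^ 2 := by
  rcases hx.eq_or_lt with rfl | hx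
  · simp [zero_rpow (div_pos hs hw).ne']
  simp_rw [exp_mul_posLog_eq_indicator hx hw]
  rw [integral_const_mul, integral_sub_left_eq_self (fun v ↦ (Set.Ioi 0).indicator
      (fun v ↦ v ^ ((2 : ℝ) - 1) * exp (-(s * v))) v), integral_gamma_two_indicator hs,
    rpow_def_of_pos hx]
  ring_nf

variable {ι : Type*} [Fintype ι] {τ γ ν : ι → ℝ} {s r : ℝ}

/-- A Young inequality, from integrating the majorization hypothesis at the cut-offs
`exp ((1 - r) * u)` and `exp (r * u)` against `exp (s * u)`. -/
lemma sum_rpow_le_add_of_sum_posLog_le (hτ : ∀ i, 0 ≤ τ i) (hγ : ∀ i, 0 ≤ γ i)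
    (hν : ∀ i, 0 ≤ ν i) (hs : 0 < s) (hr0 : 0 < r) (hr1 : r < 1)
    (h : ∀ a b : ℝ, 0 < a → 0 < b →
      ∑ i, log⁺ (τ i / (a * b)) ≤ ∑ i, log⁺ (γ i / a) + ∑ i, log⁺ (ν i / b)) :
    ∑ i, τ i ^ s ≤ (1 - r) * ∑ i, γ i ^ (s / (1 - r)) + r * ∑ i, ν i ^ (s / r) := by
  have hr' : 0 < 1 - r := sub_pos.mpr hr1
  have key : ∀ {x : ι → ℝ} {w : ℝ}, (∀ i, 0 ≤ x i) → 0 < w →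
      Integrable (fun u ↦ ∑ i, exp (s * u) * log⁺ (x i / exp (w * u))) ∧
      ∫ u, ∑ i, exp (s * u) * log⁺ (x i / exp (w * u)) = w * (∑ i, x i ^ (s / w)) / s ^ 2 := by
    intro x w hx hw
    refine ⟨integrable_finsetSum _ fun i _ ↦ integrable_exp_mul_posLog (hx i) hs hw, ?_⟩
    rw [integral_finsetSum _ fun i _ ↦ integrable_exp_mul_posLog (hx i) hs hw,
      Finset.mul_sum, Finset.sum_div]
    exact Finset.sum_congr rfl fun i _ ↦ integral_exp_mul_posLog (hx i) hs hw
  obtain ⟨iτ, eτ⟩ := key hτ one_pos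
  obtain ⟨iγ, eγ⟩ := key hγ hr'
  obtain ⟨iν, eν⟩ := key hν hr0
  have hint := integral_mono iτ (iγ.add iν) fun u ↦ by
    simp only [Pi.add_apply, ← Finset.mul_sum, ← mul_add]
    refine mul_le_mul_of_nonneg_left ?_ (exp_pos _).le
    have := h _ _ (exp_pos ((1 - r) * u)) (exp_pos (r * u))
    rwa [← exp_add, ← add_mul, sub_add_cancel] at this
  have hadd := integral_add iγ iν
  simp only [Pi.add_apply] at hint
  rw [hadd, eτ, eγ, eν, ← add_div, div_le_div_iff_of_pos_right (by positivity), one_mul,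
    div_one] at hint
  exact hint

/-- Hölder's inequality for families that satisfy a logarithmic weak majorization. -/
lemma sum_rpow_le_mul_of_sum_posLog_le (hτ : ∀ i, 0 ≤ τ i) (hγ : ∀ i, 0 ≤ γ i)
    (hν : ∀ i, 0 ≤ ν i) (hs : 0 < s) (hr0 : 0 < r) (hr1 : r < 1)
    (h : ∀ a b : ℝ, 0 < a → 0 < b →
      ∑ i, log⁺ (τ i / (a * b)) ≤ ∑ i, log⁺ (γ i / a) + ∑ i, log⁺ (ν i / b)) :
    ∑ i, τ i ^ s ≤ (∑ i, γ i ^ (s / (1 - r))) ^ (1 - r) * (∑ i, ν i ^ (s / r)) ^ r := by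
  have hr' : 0 < 1 - r := sub_pos.mpr hr1
  set G := ∑ i, γ i ^ (s / (1 - r))
  set H := ∑ i, ν i ^ (s / r)
  have hG : 0 ≤ G := Finset.sum_nonneg fun i _ ↦ rpow_nonneg (hγ i) _
  have hH : 0 ≤ H := Finset.sum_nonneg fun i _ ↦ rpow_nonneg (hν i) _
  -- The sums are enlarged by `ε` because the normalization divides by them.
  have hε : ∀ ε : ℝ, 0 < ε → ∑ i, τ i ^ s ≤ (G + ε) ^ (1 - r) * (H + ε) ^ r := by
    intro ε hε
    have hGε : 0 < G + ε := by positivity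
    have hHε : 0 < H + ε := by positivity
    set a := (G + ε) ^ ((1 - r) / s) with ha
    set b := (H + ε) ^ (r / s) with hb
    have ha0 : 0 < a := rpow_pos_of_pos hGε _
    have hb0 : 0 < b := rpow_pos_of_pos hHε _
    have has : a ^ s = (G + ε) ^ (1 - r) := by
      rw [ha, ← rpow_mul hGε.le, div_mul_cancel₀ _ hs.ne']
    have hbs : b ^ s = (H + ε) ^ r := by
      rw [hb, ← rpow_mul hHε.le, div_mul_cancel₀ _ hs.ne']
    have has' : a ^ (s / (1 - r)) = G + ε := by
      rw [ha, ← rpow_mul hGε.le, div_mul_div_cancel₀' hr'.ne', div_self hs.ne', rpow_one]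
    have hbs' : b ^ (s / r) = H + ε := by
      rw [hb, ← rpow_mul hHε.le, div_mul_div_cancel₀' hr0.ne', div_self hs.ne', rpow_one]
    have hY := sum_rpow_le_add_of_sum_posLog_le (τ := fun i ↦ τ i / (a * b))
      (γ := fun i ↦ γ i / a) (ν := fun i ↦ ν i / b) (s := s) (r := r)
      (fun i ↦ div_nonneg (hτ i) (by positivity)) (fun i ↦ div_nonneg (hγ i) ha0.le)
      (fun i ↦ div_nonneg (hν i) hb0.le) hs hr0 hr1 fun a' b' ha' hb' ↦ by
        have := h (a * a') (b * b') (by positivity) (by positivity)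
        simp only [div_div]
        rwa [mul_mul_mul_comm] at this
    have hdiv : ∀ (x : ι → ℝ) (c p : ℝ), (∀ i, 0 ≤ x i) → 0 < c →
        ∑ i, (x i / c) ^ p = (∑ i, x i ^ p) / c ^ p := by
      intro x c p hx hc
      rw [Finset.sum_div]
      exact Finset.sum_congr rfl fun i _ ↦ div_rpow (hx i) hc.le _
    rw [hdiv τ _ _ hτ (by positivity), hdiv γ _ _ hγ ha0, hdiv ν _ _ hν hb0,
      mul_rpow ha0.le hb0.le, has, hbs, has', hbs'] at hY
    have h1 : G / (G + ε) ≤ 1 := (div_le_one hGε).mpr (by linarith)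
    have h2 : H / (H + ε) ≤ 1 := (div_le_one hHε).mpr (by linarith)
    have h3 : (∑ i, τ i ^ s) / ((G + ε) ^ (1 - r) * (H + ε) ^ r) ≤ 1 := by
      refine hY.trans ?_
      nlinarith [mul_le_mul_of_nonneg_left h1 hr'.le, mul_le_mul_of_nonneg_left h2 hr0.le]
    exact (div_le_one (by positivity)).mp h3
  have hlim : Filter.Tendsto (fun ε : ℝ ↦ (G + ε) ^ (1 - r) * (H + ε) ^ r)
      (nhdsWithin 0 (Set.Ioi 0)) (nhds (G ^ (1 - r) * H ^ r)) := by
    have hc : Continuous fun ε : ℝ ↦ (G + ε) ^ (1 - r) * (H + ε) ^ r :=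
      ((continuous_const.add continuous_id).rpow_const fun _ ↦ .inr hr'.le).mul
        ((continuous_const.add continuous_id).rpow_const fun _ ↦ .inr hr0.le)
    have := hc.tendsto 0
    simp only [add_zero] at this
    exact this.mono_left nhdsWithin_le_nhds
  exact ge_of_tendsto hlim (Filter.eventually_of_mem self_mem_nhdsWithin hε)

end Scalars

/-! ### Traces of powers -/

namespace Matrix

variable {n : Type*} [Fintype n] [DecidableEq n]

lemma PosSemidef.rpow_mul_rpow {X : Matrix n n ℂ} (hX : X.PosSemidef) {a b : ℝ} (ha : 0 ≤ a)
    (hb : 0 ≤ b) : X ^ a * X ^ b = X ^ (a + b) := by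
  have h0 : 0 ≤ X := hX.nonneg
  rw [CFC.rpow_eq_cfc_real h0, CFC.rpow_eq_cfc_real h0, CFC.rpow_eq_cfc_real h0,
    ← cfc_mul _ _ X (Real.continuous_rpow_const ha).continuousOn
      (Real.continuous_rpow_const hb).continuousOn]
  exact cfc_congr fun x hx ↦
    (Real.rpow_add_of_nonneg (spectrum_nonneg_of_nonneg h0 hx) ha hb).symm

lemma posSemidef_rpow {X : Matrix n n ℂ} (a : ℝ) : (X ^ a).PosSemidef :=
  nonneg_iff_posSemidef.mp CFC.rpow_nonneg

lemma PosSemidef.trace_rpow_re {X : Matrix n n ℂ} (hX : X.PosSemidef) (p : ℝ) :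
    (X ^ p).trace.re = ∑ i, hX.1.eigenvalues i ^ p := by
  rw [CFC.rpow_eq_cfc_real hX.nonneg, hX.1.cfc_eq, IsHermitian.cfc,
    Unitary.conjStarAlgAut_apply, trace_mul_cycle, Unitary.coe_star_mul_self, one_mul,
    trace_diagonal, Complex.re_sum]
  rfl

lemma trace_rpow_re_nonneg {X : Matrix n n ℂ} (p : ℝ) : 0 ≤ (X ^ p).trace.re :=
  (Complex.le_def.mp (posSemidef_rpow p).trace_nonneg).1

lemma IsHermitian.eigenvalues_le_norm {X : Matrix n n ℂ} (hX : X.IsHermitian) (i : n) :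
    hX.eigenvalues i ≤ ‖X‖ := by
  have : Nonempty n := ⟨i⟩
  exact (le_abs_self _).trans
    (spectrum.norm_le_norm_of_mem (hX.eigenvalues_mem_spectrum_real i))

open Real in
/-- The case of interior exponents. It is Hölder's inequality for the factorization
`B ^ (1/2) * A = B ^ ((1-r)/2) * (B ^ (r/2) * A ^ r) * A ^ (1-r)`, the last factor being estimated
in operator norm. -/
theorem trace_mul_mul_rpow_le {A B : Matrix n n ℂ} (hA : A.PosSemidef) (hB : B.PosSemidef)
    {q r : ℝ} (hq : 0 < q) (hr0 : 0 < r) (hr1 : r < 1) :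
    ((A * B * A) ^ (r * q)).trace.re ≤
      (‖A‖ ^ (2 * r * q) * (B ^ (r * q)).trace.re) ^ (1 - r) *
        ((A ^ r * B ^ r * A ^ r) ^ q).trace.re ^ r := by
  have hr' : 0 < 1 - r := sub_pos.mpr hr1
  have hs : 0 < r * q := mul_pos hr0 hq
  rcases eq_or_ne A 0 with rfl | hA0
  · have hz : ((0 * B * 0 : Matrix n n ℂ) ^ (r * q)).trace.re = 0 := by
      have h0 : (0 : Matrix n n ℂ).PosSemidef := .zero
      rw [zero_mul, zero_mul, h0.trace_rpow_re, (h0.1.eigenvalues_eq_zero_iff).mpr rfl]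
      simp [zero_rpow hs.ne']
    rw [hz]
    exact mul_nonneg (rpow_nonneg (mul_nonneg (rpow_nonneg (norm_nonneg _) _)
      (trace_rpow_re_nonneg _)) _) (rpow_nonneg (trace_rpow_re_nonneg _) _)
  have hnA : 0 < ‖A‖ := norm_pos_iff.mpr hA0
  have herm : ∀ {X : Matrix n n ℂ} (a : ℝ), (X ^ a)ᴴ = X ^ a := fun a ↦ (posSemidef_rpow a).1.eq
  have hN : (A ^ r * B ^ r * A ^ r).PosSemidef := by
    simpa only [herm] using (posSemidef_rpow (X := B) r).conjTranspose_mul_mul_same (A ^ r)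
  have hT : (A * B * A).PosSemidef := by
    simpa only [hA.1.eq] using hB.conjTranspose_mul_mul_same A
  have hM : (A * B ^ r * A).PosSemidef := by
    simpa only [hA.1.eq] using (posSemidef_rpow (X := B) r).conjTranspose_mul_mul_same A
  have hC : (B ^ (1 - r)).PosSemidef := posSemidef_rpow _
  have hZ : ((A ^ (1 - r))ᴴ * A ^ (1 - r)).PosSemidef := posSemidef_conjTranspose_mul_self _
  have hBr : B ^ (r / 2) * B ^ (r / 2) = B ^ r := by
    rw [hB.rpow_mul_rpow (by positivity) (by positivity), add_halves]
  have hMY : A * B ^ r * A = (B ^ (r / 2) * A)ᴴ * (B ^ (r / 2) * A) := by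
    rw [conjTranspose_mul, herm, hA.1.eq, ← hBr]
    simp only [Matrix.mul_assoc]
  have hTY : A * B * A = (B ^ (r / 2) * A)ᴴ * B ^ (1 - r) * (B ^ (r / 2) * A) := by
    have : B = B ^ (r / 2) * B ^ (1 - r) * B ^ (r / 2) := by
      rw [hB.rpow_mul_rpow (by positivity) hr'.le, hB.rpow_mul_rpow (by positivity) (by positivity)]
      conv_lhs => rw [← CFC.rpow_one B hB.nonneg]
      congr 1
      ring
    rw [conjTranspose_mul, herm, hA.1.eq]
    conv_lhs => rw [this]
    simp only [Matrix.mul_assoc]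
  have hMN : A * B ^ r * A =
      (A ^ (1 - r))ᴴ * (A ^ r * B ^ r * A ^ r) * A ^ (1 - r) := by
    have h1 : A ^ (1 - r) * A ^ r = A := by
      rw [hA.rpow_mul_rpow hr'.le hr0.le, sub_add_cancel, CFC.rpow_one A hA.nonneg]
    have h2 : A ^ r * A ^ (1 - r) = A := by
      rw [hA.rpow_mul_rpow hr0.le hr'.le, add_sub_cancel, CFC.rpow_one A hA.nonneg]
    rw [herm]
    calc A * B ^ r * A = (A ^ (1 - r) * A ^ r) * B ^ r * (A ^ r * A ^ (1 - r)) := by rw [h1, h2]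
      _ = _ := by simp only [Matrix.mul_assoc]
  set z := ‖A‖ ^ (2 * (1 - r)) with hz
  have hz0 : 0 < z := rpow_pos_of_pos hnA _
  have hζ : ∀ i, hZ.1.eigenvalues i ≤ z := fun i ↦ by
    refine (hZ.1.eigenvalues_le_norm i).trans_eq ?_
    rw [← star_eq_conjTranspose, CStarRing.norm_star_mul_self, CFC.norm_rpow A hr' hA.nonneg,
      ← rpow_add hnA, hz, two_mul]
  have hmaj : ∀ a b : ℝ, 0 < a → 0 < b → ∑ i, log⁺ (hT.1.eigenvalues i / z / (a * b)) ≤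
      ∑ i, log⁺ (hC.1.eigenvalues i / a) + ∑ i, log⁺ (hN.1.eigenvalues i / b) := by
    intro a b ha hb
    have h1 := hC.sum_posLog_eigenvalues_le hM hT hMY hTY ha (mul_pos hb hz0)
    have h2 := hN.sum_posLog_eigenvalues_le hZ hM rfl hMN hb hz0
    have h3 : ∑ i, log⁺ (hZ.1.eigenvalues i / z) = 0 := Finset.sum_eq_zero fun i _ ↦ by
      rw [posLog_eq_zero_iff, abs_of_nonneg (div_nonneg (hZ.eigenvalues_nonneg i) hz0.le)]
      exact (div_le_one hz0).mpr (hζ i)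
    rw [h3, add_zero] at h2
    simp only [div_div]
    rw [show z * (a * b) = a * (b * z) by ring]
    exact h1.trans (add_le_add_right h2 _)
  have key := sum_rpow_le_mul_of_sum_posLog_le
    (fun i ↦ div_nonneg (hT.eigenvalues_nonneg i) hz0.le) hC.eigenvalues_nonneg
    hN.eigenvalues_nonneg hs hr0 hr1 hmaj
  simp_rw [div_rpow (hT.eigenvalues_nonneg _) hz0.le] at key
  rw [← Finset.sum_div, ← hT.trace_rpow_re, ← hC.trace_rpow_re, ← hN.trace_rpow_re,
    CFC.rpow_rpow_of_exponent_nonneg B _ _ hr'.le (div_nonneg hs.le hr'.le) hB.nonneg,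
    mul_div_cancel₀ _ hr'.ne', mul_div_cancel_left₀ _ hr0.ne',
    div_le_iff₀ (rpow_pos_of_pos hz0 _)] at key
  rw [mul_rpow (rpow_nonneg (norm_nonneg _) _) (trace_rpow_re_nonneg _),
    ← rpow_mul (norm_nonneg _)]
  rw [hz, ← rpow_mul (norm_nonneg _)] at key
  calc _ ≤ _ := key
    _ = _ := by
      rw [show 2 * (1 - r) * (r * q) = 2 * r * q * (1 - r) by ring]
      ring

end Matrix

open Matrix in
theorem theorem1 {n : Type*} [Fintype n] [DecidableEq n] (A B : Matrix n n ℂ)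
    (hA : A.PosSemidef) (hB : B.PosSemidef) (q r : ℝ) (hq : 0 ≤ q) :
    (0 ≤ r → r ≤ 1 →
      ((A * B * A) ^ (r * q)).trace.re ≤
        (‖A‖ ^ (2 * r * q) * (B ^ (r * q)).trace.re) ^ (1 - r) *
          ((A ^ r * B ^ r * A ^ r) ^ q).trace.re ^ r) ∧
    (1 ≤ r →
      (‖A‖ ^ (2 * r * q) * (B ^ (r * q)).trace.re) ^ (1 - r) *
          ((A ^ r * B ^ r * A ^ r) ^ q).trace.re ^ r ≤
        ((A * B * A) ^ (r * q)).trace.re) := by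
  have hT : (A * B * A).PosSemidef := by
    simpa only [hA.1.eq] using hB.conjTranspose_mul_mul_same A
  have hN : (A ^ r * B ^ r * A ^ r).PosSemidef := by
    simpa only [(posSemidef_rpow (X := A) r).1.eq] using
      (posSemidef_rpow (X := B) r).conjTranspose_mul_mul_same (A ^ r)
  -- At `q = 0` every power is the identity, whose trace is the size `d` of the matrices.
  rcases hq.eq_or_lt with rfl | hq
  · set d : ℝ := (1 : Matrix n n ℂ).trace.re with hd
    have hd0 : 0 ≤ d := by simp [hd]
    simp only [mul_zero, CFC.rpow_zero _ hT.nonneg, CFC.rpow_zero _ hB.nonneg,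
      CFC.rpow_zero _ hN.nonneg, Real.rpow_zero, one_mul]
    rw [← hd]
    have hpow : d ^ (1 - r) * d ^ r = d := by
      rw [← Real.rpow_add' hd0 (by simp), sub_add_cancel, Real.rpow_one]
    rw [hpow]
    exact ⟨fun _ _ ↦ le_rfl, fun _ ↦ le_rfl⟩
  have hone : r = 1 → (‖A‖ ^ (2 * r * q) * (B ^ (r * q)).trace.re) ^ (1 - r) *
      ((A ^ r * B ^ r * A ^ r) ^ q).trace.re ^ r = ((A * B * A) ^ (r * q)).trace.re := by
    rintro rfl
    simp [CFC.rpow_one A hA.nonneg, CFC.rpow_one B hB.nonneg]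
  refine ⟨fun hr0 hr1 ↦ ?_, fun hr ↦ ?_⟩
  · rcases hr1.eq_or_lt with h1 | hr1
    · exact (hone h1).ge
    rcases hr0.eq_or_lt with rfl | hr0
    · simp [CFC.rpow_zero _ hT.nonneg, CFC.rpow_zero _ hB.nonneg]
    exact trace_mul_mul_rpow_le hA hB hq hr0 hr1
  · rcases hr.eq_or_lt with h1 | hr
    · exact (hone h1.symm).le
    have hr0 : 0 < r := one_pos.trans hr
    -- The inequality at `A ^ r`, `B ^ r` and the exponents `r * q`, `r⁻¹`, solved for the trace
    -- on its right-hand side.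
    have key := trace_mul_mul_rpow_le (posSemidef_rpow (X := A) r) (posSemidef_rpow (X := B) r)
      (mul_pos hr0 hq) (inv_pos.mpr hr0) (inv_lt_one_of_one_lt₀ hr)
    have hinv : ∀ {X : Matrix n n ℂ}, X.PosSemidef → (X ^ r) ^ r⁻¹ = X := fun {X} hX ↦ by
      rw [CFC.rpow_rpow_of_exponent_nonneg X _ _ hr0.le (inv_pos.mpr hr0).le hX.nonneg,
        mul_inv_cancel₀ hr0.ne', CFC.rpow_one X hX.nonneg]
    rw [hinv hA, hinv hB, inv_mul_cancel_left₀ hr0.ne',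
      CFC.rpow_rpow_of_exponent_nonneg B _ _ hr0.le hq.le hB.nonneg,
      CFC.norm_rpow A hr0 hA.nonneg, ← Real.rpow_mul (norm_nonneg _),
      show r * (2 * r⁻¹ * (r * q)) = 2 * r * q by field_simp] at key
    set x := ‖A‖ ^ (2 * r * q) * (B ^ (r * q)).trace.re
    have hx0 : 0 ≤ x :=
      mul_nonneg (Real.rpow_nonneg (norm_nonneg _) _) (trace_rpow_re_nonneg _)
    have ht0 : 0 ≤ ((A * B * A) ^ (r * q)).trace.re := trace_rpow_re_nonneg _
    rcases hx0.eq_or_lt with hx | hx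
    -- The junk value `0 ^ (1 - r) = 0` agrees with the convention for the degenerate case.
    · rw [← hx, Real.zero_rpow (by linarith), zero_mul]
      exact ht0
    have h2 := Real.rpow_le_rpow (trace_rpow_re_nonneg _) key hr0.le
    rw [Real.mul_rpow (Real.rpow_nonneg hx0 _) (Real.rpow_nonneg ht0 _), ← Real.rpow_mul hx0,
      ← Real.rpow_mul ht0, inv_mul_cancel₀ hr0.ne', Real.rpow_one] at h2
    calc _ ≤ x ^ (1 - r) * (x ^ ((1 - r⁻¹) * r) * ((A * B * A) ^ (r * q)).trace.re) :=
          mul_le_mul_of_nonneg_left h2 (Real.rpow_nonneg hx0 _)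
      _ = ((A * B * A) ^ (r * q)).trace.re := by
          rw [← mul_assoc, ← Real.rpow_add hx,
            show 1 - r + (1 - r⁻¹) * r = 0 by field_simp; ring, Real.rpow_zero, one_mul]
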